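/- For a positive integer $n$, let $G_n$ be the prime difference graph of order $n$: its vertex set is $\{1,2,\dots,n\}$, and $u$ and $v$ are adjacent if and only if $|u-v|$ is a prime number. A 2-factor of a graph is a spanning subgraph in which every vertex has degree two. Theorem. Let $n\ge 7$. Then for every 2-factor $F$ of the complete graph $K_n$, the graph $G_n$ contains a subgraph isomorphic to $F$. Equivalently, for all $k$ and all integers $n_1,\dots,n_k\ge 3$ with $n_1+\cdots+n_k=n$, the graph $G_n$ contains cycles $C_1,\dots,C_k$ such that $C_i$ has length $n_i$ for each $i$ and every vertex of $G_n$ lies on exactly one of the $C_i$. (Both formulations are asserted.) -/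

import Mathlib

/-- The prime difference graph `G_n`: the vertices are the integers `1, 2, …, n`, and `u`, `v` are
adjacent when `|u - v|` is a prime number. -/
def primeDiffGraph (n : ℕ) : SimpleGraph (Finset.Icc 1 n) where
  Adj u v := Nat.Prime (((u : ℕ) : ℤ) - ((v : ℕ) : ℤ)).natAbs
  symm := ⟨fun u v h => by
    rw [← Int.natAbs_neg, neg_sub]
    exact h⟩
  loopless := ⟨fun u h => by
    rw [sub_self] at h
    exact Nat.not_prime_zero h⟩

/-- `F` is a 2-factor of `G`: a spanning subgraph of `G` in which all vertices have degree two. -/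
def IsTwoFactor {V : Type*} (G : SimpleGraph V) (F : G.Subgraph) : Prop :=
  F.IsSpanning ∧ ∀ v : V, (F.neighborSet v).ncard = 2

/-!
The differences `2, 3, 5, 7` already suffice. Placing tilings of consecutive intervals side by side
shows that concatenations of tileable lists of cycle lengths are tileable (`Tileable.append`), so it
is enough to tile a few indecomposable lists.

A single cycle of length at least five tiles an interval of its length (`tileable_singleton`).
Triangles and quadrilaterals alone reduce to nine explicit tilings (`tileable_replicate`), except for
`3`, `4` and `3, 3`, where there is too little room; such a remainder is tiled together with one long
cycle. For the lists containing one long cycle only finitely many lengths have to be treated by hand: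
once the long cycle passes through the six largest integers in a suitable order, it can be rerouted
there to absorb the next integer so that this order is reproduced one place higher
(`TopTileable.succ`).

A finite 2-regular graph is the disjoint union of its connected components, each of which
is a cycle graph (`SimpleGraph.Connected.exists_iso_cycleGraph`), so a 2-factor of the complete graph
is determined up to isomorphism by its cycle lengths. Hence both assertions follow from the existence of
disjoint cycles of prescribed lengths (`exists_cycleGraph_hom_primeDiffGraph`).
-/

/-! ### Tilings of intervals by step cycles -/

/-- Two naturals are a *step* apart if their distance is one of the primes `2, 3, 5, 7`. -/
def IsStep (a b : ℕ) : Prop := Nat.dist a b ∈ [2, 3, 5, 7]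

instance : DecidableRel IsStep := fun a b => inferInstanceAs (Decidable (Nat.dist a b ∈ [2, 3, 5, 7]))

/-- The list `c`, read cyclically, moves by steps; the wrap-around step is obtained by appending the
first entry of `c` at the end. -/
def IsStepCycle (c : List ℕ) : Prop := (c ++ c.take 1).IsChain IsStep

instance : DecidablePred IsStepCycle :=
  fun c => inferInstanceAs (Decidable ((c ++ c.take 1).IsChain IsStep))

/-- The integers `0, …, ls.sum - 1` can be partitioned into step cycles whose lengths are, in order,
the entries of `ls`. -/
def Tileable (ls : List ℕ) : Prop :=
  ∃ C : List (List ℕ), C.map List.length = ls ∧ (∀ c ∈ C, IsStepCycle c) ∧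
    C.flatten.Perm (List.range ls.sum)

/-- A partition of `0, …, ls.sum + L - 1` into step cycles of the lengths listed in `ls` and one step
cycle of length `L` which passes through the top six integers `m, …, m + 5` consecutively, in the
order `m, m + 3, m + 5, m + 2, m + 4, m + 1`. -/
def TopTileable (ls : List ℕ) (L : ℕ) : Prop :=
  ∃ (m : ℕ) (t : List ℕ) (C : List (List ℕ)), m + 6 = ls.sum + L ∧ t.length + 6 = L ∧
    C.map List.length = ls ∧ (∀ c ∈ C, IsStepCycle c) ∧
    IsStepCycle ([m, m + 3, m + 5, m + 2, m + 4, m + 1] ++ t) ∧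
    ([m, m + 3, m + 5, m + 2, m + 4, m + 1] ++ t ++ C.flatten).Perm (List.range (m + 6))

theorem IsStep.symm {a b : ℕ} (h : IsStep a b) : IsStep b a := by
  unfold IsStep at *
  rwa [Nat.dist_comm]

theorem isStep_add_left (a : ℕ) {k : ℕ} (hk : k ∈ [2, 3, 5, 7]) : IsStep (a + k) a := by
  unfold IsStep
  rwa [Nat.dist_eq_sub_of_le_right (Nat.le_add_right a k), Nat.add_sub_cancel_left]

theorem IsStepCycle.map_add {c : List ℕ} (h : IsStepCycle c) (N : ℕ) :
    IsStepCycle (c.map (· + N)) := by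
  unfold IsStepCycle at *
  rw [← List.map_take, ← List.map_append, List.isChain_map]
  refine h.imp fun a b hab => ?_
  unfold IsStep at *
  rwa [Nat.dist_add_add_right]

theorem Tileable.append {l₁ l₂ : List ℕ} (h₁ : Tileable l₁) (h₂ : Tileable l₂) :
    Tileable (l₁ ++ l₂) := by
  obtain ⟨C₁, hl₁, hc₁, hp₁⟩ := h₁
  obtain ⟨C₂, hl₂, hc₂, hp₂⟩ := h₂
  refine ⟨C₁ ++ C₂.map (List.map (· + l₁.sum)), ?_, ?_, ?_⟩
  · simp [hl₁, ← hl₂, Function.comp_def]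
  · intro c hc
    rcases List.mem_append.1 hc with hc | hc
    · exact hc₁ c hc
    · obtain ⟨d, hd, rfl⟩ := List.mem_map.1 hc
      exact (hc₂ d hd).map_add _
  · rw [List.flatten_append, ← List.map_flatten, List.sum_append, List.range_add]
    refine hp₁.append ?_
    simpa [add_comm] using hp₂.map (· + l₁.sum)

/-- A rearrangement of the list of values of `f` lifts to a rearrangement of the arguments. -/
theorem List.Perm.exists_perm_map_eq {α β : Type*} {f : α → β} {l₁ l₂ : List β} (h : l₁.Perm l₂) :
    ∀ C : List α, C.map f = l₁ →
      ∃ C' : List α, C.Perm C' ∧ C'.map f = l₂ := by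
  induction h with
  | nil => exact fun C hC => ⟨C, .refl _, hC⟩
  | cons x _ ih =>
    intro C hC
    obtain ⟨a, C, rfl, rfl, hC₁⟩ := List.map_eq_cons_iff.1 hC
    obtain ⟨C', hp, hC'⟩ := ih C hC₁
    exact ⟨a :: C', hp.cons a, by simp [hC']⟩
  | swap x y l =>
    intro C hC
    obtain ⟨a, C, rfl, rfl, hC₁⟩ := List.map_eq_cons_iff.1 hC
    obtain ⟨b, C, rfl, rfl, hC₂⟩ := List.map_eq_cons_iff.1 hC₁
    exact ⟨b :: a :: C, .swap _ _ _, by simp [hC₂]⟩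
  | trans _ _ ih₁ ih₂ =>
    intro C hC
    obtain ⟨C', hp, hC'⟩ := ih₁ C hC
    obtain ⟨C'', hp', hC''⟩ := ih₂ C' hC'
    exact ⟨C'', hp.trans hp', hC''⟩

theorem Tileable.perm {l₁ l₂ : List ℕ} (h : Tileable l₁) (hp : l₁.Perm l₂) : Tileable l₂ := by
  obtain ⟨C, hl, hc, hC⟩ := h
  obtain ⟨C', hCC', hC'⟩ := hp.exists_perm_map_eq C hl
  exact ⟨C', hC', fun c hc' => hc c (hCC'.mem_iff.2 hc'),
    hCC'.symm.flatten.trans (hp.sum_eq ▸ hC)⟩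

theorem Tileable.nil : Tileable [] := ⟨[], by decide⟩

/-- The long cycle is lengthened by one by rerouting it at the top: the segment
`m, m + 3, m + 5, m + 2, m + 4, m + 1` becomes `m, m + 2, m + 5, m + 3, m + 6, m + 4, m + 1`.
Read backwards, the new cycle again has the required shape, with `m + 1` in place of `m`. -/
theorem TopTileable.succ {ls : List ℕ} {L : ℕ} (h : TopTileable ls L) : TopTileable ls (L + 1) := by
  obtain ⟨m, t, C, hm, ht, hl, hc, hcyc, hp⟩ := h
  refine ⟨m + 1, m :: t.reverse, C, by omega, by simp; omega, hl, hc, ?_, ?_⟩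
  · have hchain : ((m + 1) :: (t ++ [m])).IsChain IsStep := by
      simp only [IsStepCycle, List.cons_append, List.nil_append, List.take_succ_cons, List.take_zero,
        List.isChain_cons_cons] at hcyc
      exact hcyc.2.2.2.2.2
    have hrev : (m :: (t.reverse ++ [m + 1])).IsChain IsStep := by
      have := List.isChain_reverse.2 (hchain.imp fun a b => IsStep.symm)
      simpa using this
    simp only [IsStepCycle, List.cons_append, List.nil_append, List.take_succ_cons, List.take_zero,
        List.isChain_cons_cons]
    exact ⟨(isStep_add_left (m + 1) (k := 3) (by decide)).symm,
      (isStep_add_left (m + 1 + 3) (k := 2) (by decide)).symm,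
      isStep_add_left (m + 1 + 2) (k := 3) (by decide),
      (isStep_add_left (m + 1 + 2) (k := 2) (by decide)).symm,
      isStep_add_left (m + 1 + 1) (k := 3) (by decide),
      isStep_add_left m (k := 2) (by decide), hrev⟩
  · rw [show m + 1 + 6 = m + 6 + 1 by omega, List.range_succ]
    refine List.Perm.trans ?_ (hp.append_right [m + 6])
    rw [List.perm_iff_count]
    intro a
    simp only [List.count_append, List.count_cons, List.count_nil, List.count_reverse,
      Nat.add_assoc, Nat.reduceAdd]
    omega

theorem TopTileable.of_le {ls : List ℕ} {L L' : ℕ} (h : TopTileable ls L) (hL : L ≤ L') :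
    TopTileable ls L' := by
  induction hL with
  | refl => exact h
  | step _ ih => exact ih.succ

theorem TopTileable.tileable {ls : List ℕ} {L : ℕ} (h : TopTileable ls L) : Tileable (L :: ls) := by
  obtain ⟨m, t, C, hm, ht, hl, hc, hcyc, hp⟩ := h
  refine ⟨([m, m + 3, m + 5, m + 2, m + 4, m + 1] ++ t) :: C, ?_, ?_, ?_⟩
  · simp [hl, ht]
  · simpa using ⟨hcyc, hc⟩
  · rw [List.sum_cons, Nat.add_comm L, ← hm]
    exact hp

/-! ### Tilings with one long cycle -/

theorem tileable_singleton {L : ℕ} (hL : 5 ≤ L) : Tileable [L] := by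
  rcases le_or_gt 10 L with h | h
  · exact (TopTileable.of_le (L := 10) ⟨4, [2, 0, 3, 1], [], by decide⟩ h).tileable
  · interval_cases L
    · exact ⟨[[0, 2, 4, 1, 3]], by decide⟩
    · exact ⟨[[0, 2, 4, 1, 3, 5]], by decide⟩
    · exact ⟨[[0, 2, 4, 1, 6, 3, 5]], by decide⟩
    · exact ⟨[[0, 2, 4, 1, 6, 3, 5, 7]], by decide⟩
    · exact ⟨[[0, 2, 4, 1, 3, 6, 8, 5, 7]], by decide⟩

theorem tileable_pair_three {L : ℕ} (hL : 5 ≤ L) : Tileable [L, 3] := by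
  rcases le_or_gt 9 L with h | h
  · exact (TopTileable.of_le (L := 9) ⟨6, [4, 1, 3], [[0, 2, 5]], by decide⟩ h).tileable
  · interval_cases L
    · exact ⟨[[0, 2, 4, 7, 5], [1, 3, 6]], by decide⟩
    · exact ⟨[[1, 3, 5, 8, 6, 4], [0, 2, 7]], by decide⟩
    · exact ⟨[[1, 3, 8, 6, 9, 7, 4], [0, 2, 5]], by decide⟩
    · exact ⟨[[1, 3, 6, 4, 9, 7, 10, 8], [0, 2, 5]], by decide⟩

theorem tileable_pair_four {L : ℕ} (hL : 5 ≤ L) : Tileable [L, 4] := by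
  rcases le_or_gt 8 L with h | h
  · exact (TopTileable.of_le (L := 8) ⟨6, [4, 1], [[0, 2, 5, 3]], by decide⟩ h).tileable
  · interval_cases L
    · exact ⟨[[1, 3, 5, 8, 6], [0, 2, 4, 7]], by decide⟩
    · exact ⟨[[1, 4, 7, 9, 6, 8], [0, 2, 5, 3]], by decide⟩
    · exact ⟨[[1, 4, 6, 9, 7, 10, 8], [0, 2, 5, 3]], by decide⟩

theorem tileable_triple_three {L : ℕ} (hL : 5 ≤ L) : Tileable [L, 3, 3] := by
  rcases le_or_gt 8 L with h | h
  · exact (TopTileable.of_le (L := 8) ⟨8, [6, 1], [[0, 3, 5], [2, 4, 7]], by decide⟩ h).tileable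
  · interval_cases L
    · exact ⟨[[1, 4, 7, 9, 6], [0, 2, 5], [3, 8, 10]], by decide⟩
    · exact ⟨[[4, 7, 10, 8, 11, 9], [0, 2, 5], [1, 3, 6]], by decide⟩
    · exact ⟨[[4, 7, 9, 12, 10, 8, 11], [0, 2, 5], [1, 3, 6]], by decide⟩

/-! ### Triangles and quadrilaterals, and the general case -/

theorem Tileable.replicate_add {a b c d : ℕ}
    (h₁ : Tileable (List.replicate a 3 ++ List.replicate b 4))
    (h₂ : Tileable (List.replicate c 3 ++ List.replicate d 4)) :
    Tileable (List.replicate (a + c) 3 ++ List.replicate (b + d) 4) := by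
  refine (h₁.append h₂).perm ?_
  rw [List.perm_iff_count]
  intro x
  simp only [List.count_append, List.count_replicate]
  split_ifs <;> omega

/-- Families of triangles and quadrilaterals; the excluded pairs `(a, b)` are those for which
there are between one and six integers to cover. -/
theorem tileable_replicate (a b : ℕ) (h : (a, b) ∉ [(1, 0), (2, 0), (0, 1)]) :
    Tileable (List.replicate a 3 ++ List.replicate b 4) := by
  have h30 : Tileable (List.replicate 3 3 ++ List.replicate 0 4) :=
    ⟨[[0, 2, 7], [1, 4, 6], [3, 5, 8]], by decide⟩
  have h40 : Tileable (List.replicate 4 3 ++ List.replicate 0 4) :=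
    ⟨[[0, 2, 7], [1, 3, 6], [4, 9, 11], [5, 8, 10]], by decide⟩
  have h50 : Tileable (List.replicate 5 3 ++ List.replicate 0 4) :=
    ⟨[[0, 2, 5], [1, 3, 6], [4, 9, 11], [7, 12, 14], [8, 10, 13]], by decide⟩
  have h02 : Tileable (List.replicate 0 3 ++ List.replicate 2 4) :=
    ⟨[[0, 2, 5, 7], [1, 3, 6, 4]], by decide⟩
  have h03 : Tileable (List.replicate 0 3 ++ List.replicate 3 4) :=
    ⟨[[0, 2, 5, 7], [1, 3, 10, 8], [4, 6, 9, 11]], by decide⟩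
  have h11 : Tileable (List.replicate 1 3 ++ List.replicate 1 4) :=
    ⟨[[0, 2, 5], [1, 3, 6, 4]], by decide⟩
  have h21 : Tileable (List.replicate 2 3 ++ List.replicate 1 4) :=
    ⟨[[0, 2, 5], [1, 3, 8], [4, 6, 9, 7]], by decide⟩
  have h31 : Tileable (List.replicate 3 3 ++ List.replicate 1 4) :=
    ⟨[[0, 2, 5], [1, 3, 8], [4, 6, 11], [7, 9, 12, 10]], by decide⟩
  have h12 : Tileable (List.replicate 1 3 ++ List.replicate 2 4) :=
    ⟨[[0, 2, 5], [1, 3, 10, 8], [4, 6, 9, 7]], by decide⟩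
  induction hs : a + b using Nat.strong_induction_on generalizing a b with
  | _ s ih =>
    by_cases ha : 6 ≤ a
    · obtain ⟨a, rfl⟩ := Nat.exists_eq_add_of_le' (show 3 ≤ a by omega)
      exact (ih (a + b) (by omega) a b (by simp; omega) rfl).replicate_add h30
    by_cases hb : 4 ≤ b
    · obtain ⟨b, rfl⟩ := Nat.exists_eq_add_of_le' (show 2 ≤ b by omega)
      exact (ih (a + b) (by omega) a b (by simp; omega) rfl).replicate_add h02
    have h00 : Tileable (List.replicate 0 3 ++ List.replicate 0 4) := Tileable.nil
    push Not at ha hb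
    interval_cases b
    · interval_cases a <;> first | assumption | exact absurd h (by decide)
    · interval_cases a
      · exact absurd h (by decide)
      · exact h11
      · exact h21
      · exact h31
      · exact h30.replicate_add h11
      · exact h30.replicate_add h21
    · interval_cases a
      · exact h02
      · exact h12
      · exact h11.replicate_add h11
      · exact h30.replicate_add h02
      · exact h40.replicate_add h02
      · exact h50.replicate_add h02
    · interval_cases a
      · exact h03
      · exact h11.replicate_add h02
      · exact h21.replicate_add h02
      · exact h30.replicate_add h03
      · exact h40.replicate_add h03
      · exact h50.replicate_add h03

/-- The only lists of cycle lengths that are not tileable are `[3]`, `[4]` and `[3, 3]`. A cycle of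
length at least five is tiled on its own, unless the remaining cycles form one of these lists. -/
theorem tileable_of_three_le (ls : List ℕ) (h3 : ∀ x ∈ ls, 3 ≤ x)
    (hls : ls ∉ [[3], [4], [3, 3]]) : Tileable ls := by
  induction hn : ls.length using Nat.strong_induction_on generalizing ls with
  | _ n ih =>
    by_cases hL : ∃ L ∈ ls, 5 ≤ L
    · obtain ⟨L, hmem, hL⟩ := hL
      have hperm : (L :: ls.erase L).Perm ls := (List.perm_cons_erase hmem).symm
      refine Tileable.perm ?_ hperm
      have hlen := hperm.length_eq
      rw [List.length_cons] at hlen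
      by_cases ht : ls.erase L ∈ [[3], [4], [3, 3]]
      · simp only [List.mem_cons, List.not_mem_nil, or_false] at ht
        rcases ht with ht | ht | ht <;> rw [ht]
        · exact tileable_pair_three hL
        · exact tileable_pair_four hL
        · exact tileable_triple_three hL
      · exact (tileable_singleton hL).append
          (ih _ (by omega) _ (fun x hx => h3 x (List.mem_of_mem_erase hx)) ht rfl)
    · push Not at hL
      have hperm : (List.replicate (ls.count 3) 3 ++ List.replicate (ls.count 4) 4).Perm ls := by
        rw [List.perm_iff_count]
        intro x
        rw [List.count_append, List.count_replicate, List.count_replicate]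
        by_cases hx : x ∈ ls
        · have h₁ := h3 x hx
          have h₂ := hL x hx
          interval_cases x <;> simp
        · have h0 := List.count_eq_zero.2 hx
          by_cases h : x = 3
          · subst h; simp [h0]
          · by_cases h' : x = 4
            · subst h'; simp [h0]
            · simp [h0, Ne.symm h, Ne.symm h']
      refine Tileable.perm (tileable_replicate _ _ fun hab => hls ?_) hperm
      simp only [List.mem_cons, List.not_mem_nil, or_false, Prod.mk.injEq] at hab
      simp only [List.mem_cons, List.not_mem_nil, or_false]
      rcases hab with ⟨h₁, h₂⟩ | ⟨h₁, h₂⟩ | ⟨h₁, h₂⟩ <;>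
        rw [h₁, h₂, List.replicate_zero] at hperm
      · rw [List.append_nil] at hperm
        exact Or.inl (List.perm_replicate.1 hperm.symm)
      · rw [List.append_nil] at hperm
        exact Or.inr (Or.inr (List.perm_replicate.1 hperm.symm))
      · exact Or.inr (Or.inl (List.perm_replicate.1 hperm.symm))

/-! ### Finite 2-regular graphs -/

namespace SimpleGraph

theorem cycleGraph_ncard_neighborSet {n : ℕ} (hn : 3 ≤ n) (v : Fin n) :
    ((cycleGraph n).neighborSet v).ncard = 2 := by
  obtain ⟨n, rfl⟩ := Nat.exists_eq_add_of_le' hn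
  rw [← Nat.card_coe_set_eq, Nat.card_eq_fintype_card, card_neighborSet_eq_degree,
    cycleGraph_degree_three_le]

/-- A cycle exists in a nonempty finite 2-regular graph. The neighbours of its vertices all lie on it,
because two of them do, so by connectedness it is the whole graph. -/
theorem Connected.exists_iso_cycleGraph {V : Type*} [Finite V] {G : SimpleGraph V}
    (hc : G.Connected) (h2 : ∀ v, (G.neighborSet v).ncard = 2) :
    3 ≤ Nat.card V ∧ Nonempty (G ≃g cycleGraph (Nat.card V)) := by
  obtain ⟨v⟩ := hc.nonempty
  have hcyc : G.IsCycles := fun v _ => h2 v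
  obtain ⟨p, hp, -⟩ := hcyc.exists_cycle_toSubgraph_verts_eq_connectedComponentSupp
    (ConnectedComponent.connectedComponentMk_mem (v := v))
    (Set.nonempty_of_ncard_ne_zero (by rw [h2 v]; decide))
  have h3 := hp.three_le_length
  obtain ⟨ψ⟩ := (cycleGraph_isContained_iff (by omega)).2 ⟨v, p, hp, rfl⟩
  have hnbr (x : Fin p.length) :
      ψ '' (cycleGraph p.length).neighborSet x = G.neighborSet (ψ x) := by
    refine Set.eq_of_subset_of_ncard_le ?_ ?_ (Set.toFinite _)
    · rintro _ ⟨y, hy, rfl⟩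
      exact ψ.toHom.map_adj hy
    · exact (h2 _).trans_le ((Set.ncard_image_of_injective _ ψ.injective).trans
        (cycleGraph_ncard_neighborSet h3 x)).ge
  have hsurj : Function.Surjective ψ := by
    intro w
    have hw := (reachable_iff_reflTransGen _ _).1 (hc.preconnected (ψ ⟨0, by omega⟩) w)
    induction hw with
    | refl => exact ⟨_, rfl⟩
    | tail _ hadj ih =>
      obtain ⟨x, rfl⟩ := ih
      obtain ⟨y, -, hy⟩ := (hnbr x).ge hadj
      exact ⟨y, hy⟩
  let e : Fin p.length ≃ V := Equiv.ofBijective ψ ⟨ψ.injective, hsurj⟩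
  have hcard : Nat.card V = p.length := by rw [← Nat.card_congr e, Nat.card_fin]
  rw [hcard]
  refine ⟨h3, ⟨(⟨e, fun {x y} => ⟨fun h => ?_, fun h => ψ.toHom.map_adj h⟩⟩ :
    cycleGraph p.length ≃g G).symm⟩⟩
  obtain ⟨z, hz, hzy⟩ := (hnbr x).ge h
  exact ψ.injective hzy ▸ hz

theorem ConnectedComponent.ncard_neighborSet_toSimpleGraph {V : Type*} {G : SimpleGraph V}
    (c : G.ConnectedComponent) (v : c) :
    (c.toSimpleGraph.neighborSet v).ncard = (G.neighborSet v).ncard := by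
  rw [← Set.ncard_image_of_injective _ Subtype.val_injective]
  congr 1
  ext w
  constructor
  · rintro ⟨w, hw, rfl⟩
    exact hw
  · intro hw
    exact ⟨⟨w, c.mem_supp_of_adj_mem_supp v.2 hw⟩, hw, rfl⟩

/-- A 2-regular graph is the disjoint union of its components, which are cycles, so it embeds into
every graph `H` that contains disjoint cycles of the sizes of the components. -/
theorem isContained_of_cycleGraph_hom {V W : Type*} [Finite V] {G : SimpleGraph V}
    {H : SimpleGraph W} (h2 : ∀ v, (G.neighborSet v).ncard = 2)
    (f : ∀ c : G.ConnectedComponent, cycleGraph (Nat.card c) →g H)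
    (hf : Function.Injective fun s : (c : G.ConnectedComponent) × Fin (Nat.card c) => f s.1 s.2) :
    G ⊑ H := by
  have key (c : G.ConnectedComponent) : Nonempty (c.toSimpleGraph ≃g cycleGraph (Nat.card c)) :=
    (c.connected_toSimpleGraph.exists_iso_cycleGraph fun v =>
      (c.ncard_neighborSet_toSimpleGraph v).trans (h2 v)).2
  let e c := (key c).some
  refine ⟨⟨homOfConnectedComponents G fun c => (f c).comp (e c).toHom, fun u v huv => ?_⟩⟩
  have hinj : Function.Injective
      fun s : (c : G.ConnectedComponent) × c =>
        (⟨s.1, e s.1 s.2⟩ : (c : G.ConnectedComponent) × Fin (Nat.card c)) := by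
    rintro ⟨c, x⟩ ⟨d, y⟩ h
    obtain ⟨rfl, h⟩ := Sigma.mk.inj h
    exact congrArg (Sigma.mk c) ((e c).injective (eq_of_heq h))
  exact congrArg (fun s => (s.2 : V)) (@hinj ⟨G.connectedComponentMk u, u, rfl⟩
    ⟨G.connectedComponentMk v, v, rfl⟩ (hf huv))

end SimpleGraph

/-! ### From tilings to the prime difference graph -/

theorem isStep_prime {a b : ℕ} (h : IsStep a b) : Nat.Prime ((a : ℤ) - b).natAbs := by
  have : ((a : ℤ) - b).natAbs = Nat.dist a b := by unfold Nat.dist; omega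
  rw [this]
  have h' : Nat.dist a b ∈ [2, 3, 5, 7] := h
  simp only [List.mem_cons, List.not_mem_nil, or_false] at h'
  rcases h' with h | h | h | h <;> rw [h] <;> norm_num

theorem IsStepCycle.isStep_of_adj {c : List ℕ} (hc : IsStepCycle c) {x y : Fin c.length}
    (h : (SimpleGraph.cycleGraph c.length).Adj x y) : IsStep (c.get x) (c.get y) := by
  wlog hxy : (y : ℕ) < x generalizing x y
  · refine (this h.symm ?_).symm
    have := h.ne
    omega
  have hx := x.2
  have hchain := List.isChain_iff_getElem.1 hc x
  have hchain' := List.isChain_iff_getElem.1 hc y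
  rcases SimpleGraph.cycleGraph_adj'.1 h with h | h
  · rw [Fin.sub_val_of_le hxy.le] at h
    have hxy' : (x : ℕ) = y + 1 := by omega
    have := (hchain' (by rw [List.length_append]; omega)).symm
    rw [List.getElem_append_left (by omega), List.getElem_append_left y.2] at this
    simpa only [List.get_eq_getElem, hxy'] using this
  · -- `x` is the last position and `y` the first, so the step is the wrap-around one.
    rw [Fin.coe_sub_iff_lt.2 hxy] at h
    have hy : (y : ℕ) = 0 := by omega
    have hlast : (x : ℕ) + 1 = c.length := by omega
    have := hchain (by rw [List.length_append, List.length_take]; omega)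
    rw [List.getElem_append_left hx, List.getElem_append_right (by omega)] at this
    simpa only [List.get_eq_getElem, hy, hlast, Nat.sub_self, List.getElem_take] using this

/-- Disjoint cycles of prescribed lengths in the prime difference graph, together covering it. The
family of cycles is given as homomorphisms from cycle graphs that are jointly bijective on vertices;
an integer `a` of a tiling of `0, …, n - 1` becomes the vertex `a + 1`. -/
theorem exists_cycleGraph_hom_primeDiffGraph {ι : Type*} [Fintype ι] {l : ι → ℕ} {n : ℕ}
    (hn : 7 ≤ n) (h3 : ∀ i, 3 ≤ l i) (hsum : ∑ i, l i = n) :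
    ∃ f : ∀ i, SimpleGraph.cycleGraph (l i) →g primeDiffGraph n,
      Function.Bijective fun s : (i : ι) × Fin (l i) => f s.1 s.2 := by
  let σ := Fintype.equivFin ι
  have hls : (List.ofFn (l ∘ σ.symm)).sum = n := by
    rw [List.sum_ofFn, ← hsum]
    exact σ.symm.sum_comp l
  obtain ⟨C, hl, hc, hp⟩ := tileable_of_three_le (List.ofFn (l ∘ σ.symm))
    (by simp [List.mem_ofFn, h3]) (by
      intro h
      simp only [List.mem_cons, List.not_mem_nil, or_false] at h
      rcases h with h | h | h <;> rw [h] at hls <;> simp at hls <;> omega)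
  rw [hls] at hp
  have hlen : C.length = Fintype.card ι := by simpa using congrArg List.length hl
  obtain ⟨c, hcC⟩ : ∃ c : ι → List ℕ, ∀ i, ∃ h, c i = C[(σ i : ℕ)]'h :=
    ⟨fun i => C[σ i]'(by omega), fun i => ⟨by omega, rfl⟩⟩
  have hmem (i : ι) : c i ∈ C := by
    obtain ⟨h, hi⟩ := hcC i
    exact hi ▸ List.getElem_mem h
  obtain rfl : (fun i => (c i).length) = l := by
    funext i
    obtain ⟨h, hi⟩ := hcC i
    have : (C.map List.length)[(σ i : ℕ)]'(by simpa using h) = l i := by simp [hl]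
    rw [← this, List.getElem_map, hi]
  have hrange (i : ι) (x : Fin (c i).length) : (c i)[x] < n :=
    List.mem_range.1 (hp.mem_iff.1 (List.mem_flatten.2 ⟨c i, hmem i, List.getElem_mem _⟩))
  obtain ⟨hnodup, hdisj⟩ := List.nodup_flatten.1 (hp.nodup_iff.2 List.nodup_range)
  let f i : SimpleGraph.cycleGraph (c i).length →g primeDiffGraph n :=
    { toFun := fun x => ⟨(c i)[x] + 1, Finset.mem_Icc.2 ⟨by omega, hrange i x⟩⟩
      map_rel' := fun {x y} h => by
        have := isStep_prime ((hc _ (hmem i)).isStep_of_adj h)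
        simpa [primeDiffGraph] using this }
  refine ⟨f, (Fintype.bijective_iff_injective_and_card _).2 ⟨?_, ?_⟩⟩
  · rintro ⟨i, x⟩ ⟨j, y⟩ hxy
    have hxy : (c i)[x] = (c j)[y] := by simpa [f] using hxy
    obtain rfl : i = j := by
      by_contra hij
      have hne : (σ i : ℕ) ≠ σ j := fun h => hij (σ.injective (Fin.ext h))
      obtain ⟨hi, hi'⟩ := hcC i
      obtain ⟨hj, hj'⟩ := hcC j
      have hxi : (c i)[x] ∈ c i := List.getElem_mem _
      have hyj : (c j)[y] ∈ c j := List.getElem_mem _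
      rw [List.pairwise_iff_getElem] at hdisj
      rcases lt_or_gt_of_ne hne with h | h
      · exact hdisj _ _ hi hj h (hi' ▸ hxi) (hj' ▸ hxy ▸ hyj)
      · exact hdisj _ _ hj hi h (hj' ▸ hyj) (hi' ▸ hxy ▸ hxi)
    obtain rfl : x = y := Fin.ext ((hnodup _ (hmem i)).getElem_inj_iff.1 hxy)
    rfl
  · simp [hsum]

theorem cycleGraph_mem_support_cycle {n : ℕ} (x : Fin (n + 3)) :
    x ∈ (SimpleGraph.cycleGraph.cycle n).support := by
  rw [SimpleGraph.Walk.mem_support_iff_exists_getVert]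
  refine ⟨n + 3 - x, ?_, by simp⟩
  rw [SimpleGraph.cycleGraph.getVert_cycle (by omega)]
  ext
  simp only [Nat.sub_sub_self x.2.le, Nat.mod_eq_of_lt x.2]

theorem mainTheorem3 (n : ℕ) (hn : 7 ≤ n) :
    (∀ F : (SimpleGraph.completeGraph (Fin n)).Subgraph, IsTwoFactor (SimpleGraph.completeGraph (Fin n)) F →
      SimpleGraph.IsContained F.coe (primeDiffGraph n)) ∧
    (∀ (k : ℕ) (l : Fin k → ℕ), (∀ i, 3 ≤ l i) → ∑ i, l i = n →
      ∃ (a : Fin k → Finset.Icc 1 n) (c : ∀ i, (primeDiffGraph n).Walk (a i) (a i)),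
        (∀ i, (c i).IsCycle ∧ (c i).length = l i) ∧
        (∀ i j, i ≠ j → ∀ x, x ∈ (c i).support → x ∉ (c j).support) ∧
        (∀ x, ∃ i, x ∈ (c i).support)) := by
  constructor
  · intro F hF
    have h2 (v : F.verts) : (F.coe.neighborSet v).ncard = 2 := by
      rw [← hF.2 v, ← Nat.card_coe_set_eq, ← Nat.card_coe_set_eq]
      exact Nat.card_congr (F.coeNeighborSetEquiv v)
    have : Fintype F.coe.ConnectedComponent := Fintype.ofFinite _
    have h3 (c : F.coe.ConnectedComponent) : 3 ≤ Nat.card c :=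
      (c.connected_toSimpleGraph.exists_iso_cycleGraph fun v =>
        (c.ncard_neighborSet_toSimpleGraph v).trans (h2 v)).1
    have hsum : ∑ c : F.coe.ConnectedComponent, Nat.card c = n := by
      rw [← Nat.card_sigma]
      exact (Nat.card_congr (Equiv.sigmaFiberEquiv F.coe.connectedComponentMk)).trans
        ((Nat.card_congr (Equiv.subtypeUnivEquiv hF.1)).trans (Nat.card_fin n))
    obtain ⟨f, hf⟩ := exists_cycleGraph_hom_primeDiffGraph hn h3 hsum
    exact SimpleGraph.isContained_of_cycleGraph_hom h2 f hf.1
  · intro k l h3 hsum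
    obtain ⟨f, hf⟩ := exists_cycleGraph_hom_primeDiffGraph hn h3 hsum
    have hcyc (i : Fin k) : ∃ (v : Fin (l i)) (p : (SimpleGraph.cycleGraph (l i)).Walk v v),
        p.IsCycle ∧ p.length = l i ∧ ∀ x, x ∈ p.support := by
      obtain ⟨m, hm⟩ := Nat.exists_eq_add_of_le' (h3 i)
      rw [hm]
      exact ⟨0, SimpleGraph.cycleGraph.cycle m, SimpleGraph.cycleGraph.isCycle_cycle,
        SimpleGraph.cycleGraph.length_cycle, cycleGraph_mem_support_cycle⟩
    choose v p hp hlen hsupp using hcyc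
    have hinj (i : Fin k) : Function.Injective (f i) := fun x y h =>
      sigma_mk_injective (β := fun i => Fin (l i)) (hf.1 (a₁ := ⟨i, x⟩) (a₂ := ⟨i, y⟩) h)
    refine ⟨fun i => f i (v i), fun i => (p i).map (f i), fun i => ⟨?_, ?_⟩, ?_, fun x => ?_⟩
    · exact (SimpleGraph.Walk.isCycle_map_iff_of_injective (hinj i)).2 (hp i)
    · rw [SimpleGraph.Walk.length_map, hlen]
    · intro i j hij x hi hj
      rw [SimpleGraph.Walk.support_map, List.mem_map] at hi hj
      obtain ⟨y, -, rfl⟩ := hi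
      obtain ⟨z, -, hz⟩ := hj
      exact hij (congrArg Sigma.fst (hf.1 (a₁ := ⟨j, z⟩) (a₂ := ⟨i, y⟩) hz)).symm
    · obtain ⟨⟨i, y⟩, rfl⟩ := hf.2 x
      exact ⟨i, by simpa using ⟨y, hsupp i y, rfl⟩⟩
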